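/- Let $P\subset\mathbb R^d$ be a $d$-polytope, $d\ge 3$. A facet, ridge, subridge of $P$ is a face of dimension $d-1$, $d-2$, $d-3$; two distinct facets are adjacent if they intersect in a ridge, and $\mathrm{adj}(F)$ is the set of facets adjacent to $F$. For a facet $F$ let $H_F$ be its affine hull; a point is beneath (beyond) $F$ if it lies in the open half-space bounded by $H_F$ on the same side as (the side opposite to) $P$. For a polytope $Q$ and a set $G$, let $\mathrm{fdeg}_Q(G)$ be the number of facets of $Q$ containing $G$. Let $S$ be a facet of $P$ that is combinatorially equivalent to a $(d-1)$-simplex and is in bounded position, i.e. the hyperplanes of any $d$ facets in $\mathrm{adj}(S)$ intersect in exactly one point, and this point is beyond $S$. Let $\mathcal F\subseteq\mathrm{adj}(S)$ be nonsimple, i.e. there are no two adjacent facets in $\mathcal F$ that have a common $(d-3)$-face with $S$. For $\mathcal N\subseteq\mathrm{adj}(S)\setminus\mathcal F$, a pseudo-stacking $\mathrm{PS}_{\mathcal F,\mathcal N}(P)$ of $P$ above $S$ is the convex hull of $P\cup\{v\}$, where $v$ is any point that is beyond $S$ and beyond every facet in $\mathcal N$, lies on $H_F$ for every $F\in\mathcal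 F$, and is beneath every other facet of $P$. Let $G$ be a subridge of $P$ and $\varphi:=|\{F\in\mathcal F : G\subseteq F\}|$. (A) If $G\subseteq S$, then $0\le\varphi\le 2$, and for every pseudo-stacking $Q=\mathrm{PS}_{\mathcal F,\emptyset}(P)$ the set $G$ is a face of $Q$ and $$\mathrm{fdeg}_Q(G)=\mathrm{fdeg}_P(G)+1-\varphi .$$ (B) Let $N\in\mathrm{adj}(S)\setminus\mathcal F$ and let $Q=\mathrm{PS}_{\mathcal F,\{N\}}(P)$ be a pseudo-stacking. (1) If $G\subseteq S$ and $G\not\subseteq N$, then $G$ is a face of $Q$ and $\mathrm{fdeg}_Q(G)=\mathrm{fdeg}_P(G)+1-\varphi$. (2) Let $G\subseteq N$ (where $G\subseteq S$ is not required). If every facet of $P$ containing $G$ is $S$, $N$ or in $\mathcal F$, then $G$ is not a face of $Q$. Otherwise $G$ is a face of $Q$ and $$\mathrm{fdeg}_Q(G)=\mathrm{fdeg}_P(G)+1-\varepsilon-\varphi ,$$ where $\varepsilon=1$ if $G\subseteq S$ and $\varepsilon=0$ if not. -/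

import Mathlib

namespace PseudoStacking

/-- The ambient space `ℝ^d`. -/
abbrev Space (d : ℕ) := EuclideanSpace ℝ (Fin d)

/-- `G` is a face of the polytope `P`: it is empty, or it is the set of maximisers over `P` of a
linear functional (the functional `0` gives `P` itself). -/
def IsFace {V : Type*} [TopologicalSpace V] [AddCommGroup V] [Module ℝ V] (P G : Set V) : Prop :=
  IsExposed ℝ P G

/-- The faces of `P` (with `∅` and `P`), partially ordered by inclusion. -/
abbrev FacePoset {V : Type*} [TopologicalSpace V] [AddCommGroup V] [Module ℝ V] (P : Set V) :=
  {G : Set V // IsFace P G}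

/-- Two polytopes are combinatorially equivalent if their face lattices are isomorphic. -/
def CombEquiv {V W : Type*} [TopologicalSpace V] [AddCommGroup V] [Module ℝ V]
    [TopologicalSpace W] [AddCommGroup W] [Module ℝ W] (P : Set V) (Q : Set W) : Prop :=
  Nonempty (FacePoset P ≃o FacePoset Q)

/-- The dimension of a nonempty set: that of its affine hull. -/
noncomputable def dim {d : ℕ} (A : Set (Space d)) : ℕ :=
  Module.finrank ℝ (vectorSpan ℝ A)

/-- `P` is a `d`-polytope in `ℝ^d`. -/
def IsFullPolytope {d : ℕ} (P : Set (Space d)) : Prop :=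
  P.Nonempty ∧ (∃ V : Set (Space d), V.Finite ∧ P = convexHull ℝ V) ∧ dim P = d

/-- `G` is a nonempty face of dimension `d - j` of the `d`-polytope `P`. -/
def IsCodimFace {d : ℕ} (j : ℕ) (P G : Set (Space d)) : Prop :=
  IsFace P G ∧ G.Nonempty ∧ dim G + j = d

/-- The facets of a `d`-polytope: its `(d-1)`-faces. -/
def facets {d : ℕ} (P : Set (Space d)) : Set (Set (Space d)) :=
  {F | IsCodimFace 1 P F}

/-- A ridge of a `d`-polytope: a `(d-2)`-face. -/
def IsRidge {d : ℕ} (P R : Set (Space d)) : Prop :=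
  IsCodimFace 2 P R

/-- A subridge of a `d`-polytope: a `(d-3)`-face. -/
def IsSubridge {d : ℕ} (P G : Set (Space d)) : Prop :=
  IsCodimFace 3 P G

/-- A simplex facet: a facet combinatorially equivalent to a `(d-1)`-simplex. -/
def IsSimplexFacet {d : ℕ} (P S : Set (Space d)) : Prop :=
  S ∈ facets P ∧ CombEquiv S (stdSimplex ℝ (Fin d))

/-- The facets of `P` adjacent to `F`: those that share a ridge of `P` with `F`. -/
def adj {d : ℕ} (P F : Set (Space d)) : Set (Set (Space d)) :=
  {F' | F' ∈ facets P ∧ F' ≠ F ∧ IsRidge P (F ∩ F')}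

/-- The hyperplane spanned by a facet `F`. -/
def hyp {d : ℕ} (F : Set (Space d)) : Set (Space d) :=
  (affineSpan ℝ F : Set (Space d))

/-- The open half-space bounded by the hyperplane of the facet `F`, on the side of `P`: its points
lie beneath `F`. -/
def posSide {d : ℕ} (P F : Set (Space d)) : Set (Space d) :=
  {x | ∃ (l : Space d →L[ℝ] ℝ) (c : ℝ),
    (∀ y ∈ F, l y = c) ∧ (∀ y ∈ P, c ≤ l y) ∧ c < l x}

/-- The open half-space bounded by the hyperplane of the facet `F`, on the side opposite to `P`: its
points lie beyond `F`. -/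
def negSide {d : ℕ} (P F : Set (Space d)) : Set (Space d) :=
  {x | ∃ (l : Space d →L[ℝ] ℝ) (c : ℝ),
    (∀ y ∈ F, l y = c) ∧ (∀ y ∈ P, c ≤ l y) ∧ l x < c}

/-- The region of all points beyond `S` and the facets in `𝓝`, on the hyperplanes of the facets in
`𝓕`, and beneath all other facets of `P`. -/
def region {d : ℕ} (P S : Set (Space d)) (𝓕 𝓝 : Set (Set (Space d))) : Set (Space d) :=
  (⋂ F ∈ facets P \ (𝓕 ∪ 𝓝 ∪ {S}), posSide P F) ∩ (⋂ F ∈ 𝓕, hyp F) ∩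
    (⋂ F ∈ 𝓝 ∪ {S}, negSide P F)

/-- `Q` is a pseudo-stacking of `P` above `S` with respect to `𝓕` and `𝓝`: the convex hull of `P`
and a point of the region above. -/
def IsPseudoStacking {d : ℕ} (P S : Set (Space d)) (𝓕 𝓝 : Set (Set (Space d)))
    (Q : Set (Space d)) : Prop :=
  ∃ v ∈ region P S 𝓕 𝓝, Q = convexHull ℝ (P ∪ {v})

/-- A set `𝓕` of facets adjacent to `S` is nonsimple if no two adjacent facets in `𝓕` have a common
`(d-3)`-face with `S`. -/
def Nonsimple {d : ℕ} (P S : Set (Space d)) (𝓕 : Set (Set (Space d))) : Prop :=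
  ¬ ∃ A ∈ 𝓕, ∃ B ∈ 𝓕, B ∈ adj P A ∧ ∃ K, IsSubridge P K ∧ K ⊆ A ∧ K ⊆ B ∧ K ⊆ S

/-- The facet `S` is in bounded position: any `d` hyperplanes of facets adjacent to `S` intersect in
a single point, and this point lies beyond `S`. -/
def BoundedPosition {d : ℕ} (P S : Set (Space d)) : Prop :=
  ∀ 𝓐 ⊆ adj P S, 𝓐.ncard = d → ∃ p ∈ negSide P S, (⋂ F ∈ 𝓐, hyp F) = {p}

/-- The number of members of `𝓐` that contain `G`. -/
noncomputable def numContaining {d : ℕ} (𝓐 : Set (Set (Space d))) (G : Set (Space d)) : ℕ :=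
  {F | F ∈ 𝓐 ∧ G ⊆ F}.ncard

/-- The number of facets of `P` that contain `G`. -/
noncomputable def fdeg {d : ℕ} (P G : Set (Space d)) : ℕ :=
  numContaining (facets P) G

open Classical in
/-- The correction term: `1` if `G ⊆ S`, and `0` otherwise. -/
noncomputable def eps {d : ℕ} (S G : Set (Space d)) : ℕ :=
  if G ⊆ S then 1 else 0

end PseudoStacking

open PseudoStacking

/-!
Write `v` for the apex of the pseudo-stacking `Q` and let `G` be a subridge of `P`. Everything
reduces to one count: if `v` is beneath some facet of `P` through `G` and beyond another one, then
the facets of `Q` through `G` are the facets of `P` through `G` that `v` is beneath, and exactly two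
more. (In the polygon dual to `G`, whose vertices are the facets of `P` through `G`, adding `v` cuts
along a line through the interior, and the cut polygon has the surviving vertices and the two end
points of the cut.)

To see this without polygons, note first that a facet of `Q` without `v` is the same as a facet of
`P` that `v` is beneath. Next, let `l` be a functional exposing `G` in `P`. Adding to `l` a
nonnegative multiple of the normal of the facet on the appropriate side of `v` makes `v` lie on the
supporting hyperplane, so the convex hull of `G` and `v` is a face of `Q`, of codimension two
(`isRidge_join`). The facets of `Q` through `G` and `v` are those through this ridge, and a ridge
lies in exactly two facets (`IsRidge.fdeg_eq_two`). This gives `fdeg_convexHull_union`.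

The facets of `P` through `G` are those that `v` is beneath, the members of `𝓕` that contain `G`,
and those of `S` (and `N`) that contain `G`; subtracting gives the stated degrees.
The remaining points are:

* A facet through `G` that `v` is beneath exists if `G ⊆ S` and `v` is beyond no other facet
  through `G`. Otherwise all facets through `G` are `S` or in `𝓕`; as there are at least three, and
  at most two in `𝓕` (`numContaining_le_two`), they are `S`, `A`, `B`, and then `A` and `B` are
  adjacent, against nonsimplicity (`Nonsimple.exists_facet`).
* If `v` is beneath no facet through `G`, then the line from `v` through a relative interior point
  of `G` continues into `P`, so `G` is not a face of `Q` (`not_isFace_convexHull_union`).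

The facts on polytopes behind this rest on the description of a full-dimensional polytope as the
intersection of its facet half-spaces (`exists_facet_beyond`), obtained from an extreme point of the
polar. Both upper bounds, "at most two facets through a ridge" and "at most two facets adjacent to
`S` through a subridge of `S`", are instances of `false_of_three_facets`.
-/

namespace PseudoStacking

open Module

variable {d : ℕ} {P F G R S N : Set (Space d)} {v : Space d}

/-! ### Faces and their supporting functionals -/

theorem IsFullPolytope.vectorSpan_eq_top (hP : IsFullPolytope P) : vectorSpan ℝ P = ⊤ := by
  apply Submodule.eq_top_of_finrank_eq
  rw [finrank_euclideanSpace_fin]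
  exact hP.2.2

theorem IsFullPolytope.convex (hP : IsFullPolytope P) : Convex ℝ P := by
  obtain ⟨_, ⟨V, _, rfl⟩, _⟩ := hP
  exact convex_convexHull ℝ V

theorem isFace_of_functional {l : Space d →L[ℝ] ℝ} {m : ℝ}
    (hl : ∀ x ∈ P, l x ≤ m) : IsFace P {x ∈ P | l x = m} := by
  rintro ⟨w, hw, hwm⟩
  refine ⟨l, Set.ext fun x => and_congr_right fun hx => ⟨fun h y hy => h ▸ hl y hy, fun h => ?_⟩⟩
  exact le_antisymm (hl x hx) (hwm ▸ h w hw)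

theorem IsFace.exists_functional (hG : IsFace P G) (hne : G.Nonempty) :
    ∃ (l : Space d →L[ℝ] ℝ) (m : ℝ), G = {x ∈ P | l x = m} ∧ ∀ x ∈ P, l x ≤ m := by
  obtain ⟨l, rfl⟩ := hG hne
  obtain ⟨w, hw, hwm⟩ := hne
  refine ⟨l, l w, Set.ext fun x => and_congr_right fun hx => ⟨fun h => ?_, fun h y hy => ?_⟩, hwm⟩
  · exact le_antisymm (hwm x hx) (h w hw)
  · exact h ▸ hwm y hy

theorem vectorSpan_le_ker {A : Set (Space d)} {l : Space d →L[ℝ] ℝ} {m : ℝ}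
    (h : ∀ x ∈ A, l x = m) : vectorSpan ℝ A ≤ LinearMap.ker (l : Space d →ₗ[ℝ] ℝ) := by
  rw [vectorSpan_def, Submodule.span_le]
  rintro _ ⟨x, hx, y, hy, rfl⟩
  simp [h x hx, h y hy]

/-- A face contained in another face of no larger dimension is equal to it. -/
theorem IsFace.eq_of_subset_of_dim_le {A B : Set (Space d)} (hA : IsFace P A) (hne : A.Nonempty)
    (hB : IsFace P B) (hAB : A ⊆ B) (hdim : dim B ≤ dim A) : A = B := by
  obtain ⟨l, m, hl, -⟩ := hA.exists_functional hne
  have hspan : vectorSpan ℝ A = vectorSpan ℝ B :=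
    Submodule.eq_of_le_of_finrank_le (vectorSpan_mono ℝ hAB) hdim
  refine hAB.antisymm fun x hx => ?_
  obtain ⟨a, ha⟩ := hne
  have h1 : x - a ∈ vectorSpan ℝ A := hspan ▸ vsub_mem_vectorSpan ℝ hx (hAB ha)
  have h2 := vectorSpan_le_ker (l := l) (m := m) (fun y hy => by rw [hl] at hy; exact hy.2) h1
  rw [hl] at ha ⊢
  refine ⟨hB.subset hx, ?_⟩
  have : l (x - a) = 0 := h2
  rw [map_sub, ha.2] at this
  linarith

theorem IsFace.dim_lt_of_ssubset {A B : Set (Space d)} (hA : IsFace P A) (hne : A.Nonempty)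
    (hB : IsFace P B) (hAB : A ⊂ B) : dim A < dim B := by
  by_contra! h
  exact hAB.ne (hA.eq_of_subset_of_dim_le hne hB hAB.subset h)

/-- A pair `(l, m)` such that `l ≤ m` on `P`, with equality exactly on `F`; a junk value if there is
no such pair, so that it is meaningful when `F` is a nonempty face of `P`. -/
noncomputable def supporting (P F : Set (Space d)) : (Space d →L[ℝ] ℝ) × ℝ :=
  Classical.epsilon fun p => F = {x ∈ P | p.1 x = p.2} ∧ ∀ x ∈ P, p.1 x ≤ p.2

/-- An outer normal functional of the face `F` of `P`. -/
noncomputable def normal (P F : Set (Space d)) : Space d →L[ℝ] ℝ := (supporting P F).1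

/-- The signed height over the supporting hyperplane of the face `F` of `P`: for a facet `F`, it is
negative beneath `F`, zero on the hyperplane of `F` and positive beyond `F`. -/
noncomputable def height (P F : Set (Space d)) (x : Space d) : ℝ :=
  normal P F x - (supporting P F).2

theorem height_sub_height (P F : Set (Space d)) (x y : Space d) :
    height P F x - height P F y = normal P F (x - y) := by
  simp [height]

theorem IsFace.supporting_spec (hF : IsFace P F) (hne : F.Nonempty) :
    F = {x ∈ P | height P F x = 0} ∧ ∀ x ∈ P, height P F x ≤ 0 := by
  obtain ⟨l, m, h⟩ := hF.exists_functional hne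
  have := Classical.epsilon_spec (p := fun p : (Space d →L[ℝ] ℝ) × ℝ =>
    F = {x ∈ P | p.1 x = p.2} ∧ ∀ x ∈ P, p.1 x ≤ p.2) ⟨(l, m), h⟩
  simpa only [height, normal, supporting, sub_eq_zero, sub_nonpos] using this

/-! ### Facets -/

theorem height_nonpos (hF : F ∈ facets P) {x : Space d} (hx : x ∈ P) : height P F x ≤ 0 :=
  (hF.1.supporting_spec hF.2.1).2 x hx

theorem mem_facet_iff (hF : F ∈ facets P) {x : Space d} : x ∈ F ↔ x ∈ P ∧ height P F x = 0 :=
  Set.ext_iff.1 (hF.1.supporting_spec hF.2.1).1 x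

theorem height_eq_zero (hF : F ∈ facets P) {x : Space d} (hx : x ∈ F) : height P F x = 0 :=
  ((mem_facet_iff hF).1 hx).2

theorem height_neg (hF : F ∈ facets P) {x : Space d} (hx : x ∈ P) (hxF : x ∉ F) :
    height P F x < 0 :=
  lt_of_le_of_ne (height_nonpos hF hx) fun h => hxF ((mem_facet_iff hF).2 ⟨hx, h⟩)

theorem facet_ne (hP : IsFullPolytope P) (hF : F ∈ facets P) : F ≠ P := by
  rintro rfl
  have h1 := hF.2.2
  have h2 := hP.2.2
  omega

theorem exists_height_neg (hP : IsFullPolytope P) (hF : F ∈ facets P) :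
    ∃ x ∈ P, height P F x < 0 := by
  obtain ⟨x, hx, hxF⟩ := Set.exists_of_ssubset (hF.1.subset.ssubset_of_ne (facet_ne hP hF))
  exact ⟨x, hx, height_neg hF hx hxF⟩

theorem vectorSpan_le_ker_normal (hF : F ∈ facets P) (hG : G ⊆ F) :
    vectorSpan ℝ G ≤ LinearMap.ker (normal P F : Space d →ₗ[ℝ] ℝ) :=
  vectorSpan_le_ker (m := (supporting P F).2) fun _ hx => sub_eq_zero.1 (height_eq_zero hF (hG hx))

theorem normal_ne_zero (hP : IsFullPolytope P) (hF : F ∈ facets P) : normal P F ≠ 0 := by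
  intro h
  obtain ⟨x, -, hx⟩ := exists_height_neg hP hF
  obtain ⟨y, hy⟩ := hF.2.1
  have := height_sub_height P F x y
  rw [h, height_eq_zero hF hy] at this
  simp at this
  exact hx.ne this

theorem finrank_ker_add_one {l : Space d →L[ℝ] ℝ} (hl : l ≠ 0) :
    finrank ℝ (LinearMap.ker (l : Space d →ₗ[ℝ] ℝ)) + 1 = d := by
  have := Module.Dual.finrank_ker_add_one_of_ne_zero (K := ℝ) (f := (l : Space d →ₗ[ℝ] ℝ))
    fun h => hl (ContinuousLinearMap.coe_injective h)
  rwa [finrank_euclideanSpace_fin] at this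

theorem vectorSpan_facet (hP : IsFullPolytope P) (hF : F ∈ facets P) :
    vectorSpan ℝ F = LinearMap.ker (normal P F : Space d →ₗ[ℝ] ℝ) := by
  refine Submodule.eq_of_le_of_finrank_le (vectorSpan_le_ker_normal hF subset_rfl) ?_
  have h1 := finrank_ker_add_one (normal_ne_zero hP hF)
  have h2 : finrank ℝ (vectorSpan ℝ F) + 1 = d := hF.2.2
  omega

/-- A functional that is constant on a facet and minimal there is a nonpositive multiple of the
outer normal. -/
theorem exists_eq_mul_height (hP : IsFullPolytope P) (hF : F ∈ facets P) {l : Space d →L[ℝ] ℝ}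
    {c : ℝ} (hlF : ∀ y ∈ F, l y = c) (hlP : ∀ y ∈ P, c ≤ l y) :
    ∃ r ≤ 0, ∀ x, l x - c = r * height P F x := by
  have hker := vectorSpan_le_ker hlF
  rw [vectorSpan_facet hP hF] at hker
  obtain ⟨w, hw, hwneg⟩ := exists_height_neg hP hF
  obtain ⟨y, hy⟩ := hF.2.1
  have key : ∀ x, l x - c = (l w - c) / height P F w * height P F x := fun x => by
    have h1 : height P F w • (x - y) - height P F x • (w - y) ∈
        LinearMap.ker (l : Space d →ₗ[ℝ] ℝ) := by
      apply hker
      have hx := height_sub_height P F x y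
      have hw := height_sub_height P F w y
      rw [height_eq_zero hF hy, sub_zero] at hx hw
      simp only [LinearMap.mem_ker, ContinuousLinearMap.coe_coe, map_sub (normal P F) (_ • _),
        map_smul, ← hx, ← hw, smul_eq_mul]
      ring
    simp only [LinearMap.mem_ker, ContinuousLinearMap.coe_coe, map_sub, map_smul, smul_eq_mul,
      hlF y hy] at h1
    rw [div_mul_eq_mul_div, eq_div_iff hwneg.ne]
    linarith
  exact ⟨_, div_nonpos_of_nonneg_of_nonpos (sub_nonneg.2 (hlP w hw)) hwneg.le, key⟩

theorem mem_posSide_iff (hP : IsFullPolytope P) (hF : F ∈ facets P) {x : Space d} :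
    x ∈ posSide P F ↔ height P F x < 0 := by
  constructor
  · rintro ⟨l, c, hlF, hlP, hx⟩
    obtain ⟨r, hr, h⟩ := exists_eq_mul_height hP hF hlF hlP
    have := h x
    nlinarith
  · intro hx
    refine ⟨-normal P F, -(supporting P F).2, fun y hy => ?_, fun y hy => ?_, ?_⟩
    · have := height_eq_zero hF hy
      simp [height] at this ⊢; linarith
    · have := height_nonpos hF hy
      simp [height] at this ⊢; linarith
    · simp [height] at hx ⊢; linarith

theorem mem_negSide_iff (hP : IsFullPolytope P) (hF : F ∈ facets P) {x : Space d} :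
    x ∈ negSide P F ↔ 0 < height P F x := by
  constructor
  · rintro ⟨l, c, hlF, hlP, hx⟩
    obtain ⟨r, hr, h⟩ := exists_eq_mul_height hP hF hlF hlP
    have := h x
    nlinarith
  · intro hx
    refine ⟨-normal P F, -(supporting P F).2, fun y hy => ?_, fun y hy => ?_, ?_⟩
    · have := height_eq_zero hF hy
      simp [height] at this ⊢; linarith
    · have := height_nonpos hF hy
      simp [height] at this ⊢; linarith
    · simp [height] at hx ⊢; linarith

theorem height_eq_zero_of_mem_hyp (hF : F ∈ facets P) {x : Space d} (hx : x ∈ hyp F) :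
    height P F x = 0 := by
  obtain ⟨y, hy⟩ := hF.2.1
  have h1 : x - y ∈ vectorSpan ℝ F := by
    rw [← direction_affineSpan]
    exact AffineSubspace.vsub_mem_direction hx (mem_affineSpan ℝ hy)
  have h2 : normal P F (x - y) = 0 := vectorSpan_le_ker_normal hF subset_rfl h1
  rw [← height_sub_height, height_eq_zero hF hy] at h2
  linarith

/-- A face of the convex hull of `V` is the convex hull of the points of `V` on it. -/
theorem IsFace.eq_convexHull_inter {V : Set (Space d)} (hF : IsFace (convexHull ℝ V) F) :
    F = convexHull ℝ (V ∩ F) := by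
  rcases F.eq_empty_or_nonempty with rfl | hne
  · simp
  refine Set.Subset.antisymm (fun x hx => ?_) ((convexHull_mono Set.inter_subset_right).trans
    (convexHull_eq_self.2 (hF.convex (convex_convexHull ℝ V))).subset)
  obtain ⟨l, m, hFl, hl⟩ := hF.exists_functional hne
  have hx' := hx
  rw [hFl] at hx'
  have hVP := subset_convexHull ℝ V
  by_cases hlt : (V \ F).Nonempty
  swap
  · rw [Set.not_nonempty_iff_eq_empty, Set.sdiff_eq_empty] at hlt
    rw [Set.inter_eq_left.2 hlt]; exact hx'.1
  have hlow : convexHull ℝ (V \ F) ⊆ {y | l y < m} := by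
    refine convexHull_min (fun y hy => ?_) (convex_halfSpace_lt l.toLinearMap.isLinear m)
    refine lt_of_le_of_ne (hl y (hVP hy.1)) fun h => hy.2 ?_
    rw [hFl]; exact ⟨hVP hy.1, h⟩
  have hVF : (V ∩ F).Nonempty := by
    rw [Set.nonempty_iff_ne_empty]
    intro h
    have : V \ F = V := by rw [← Set.sdiff_self_inter, h, Set.sdiff_empty]
    rw [this] at hlow
    exact (hlow hx'.1).ne hx'.2
  have hx1 := hx'.1
  rw [← Set.inter_union_sdiff V F, convexHull_union hVF hlt, mem_convexJoin] at hx1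
  obtain ⟨a, ha, b, hb, s, t, hs, ht, hst, rfl⟩ := hx1
  have hla : l a = m := by
    refine (convexHull_min ?_ (convex_hyperplane l.toLinearMap.isLinear m) ha : a ∈ {y | l y = m})
    intro y hy
    have := hy.2
    rw [hFl] at this; exact this.2
  have hlb : l b < m := hlow hb
  have ht0 : t = 0 := by
    have h := hx'.2
    simp only [map_add, map_smul, smul_eq_mul, hla] at h
    by_contra hne
    have : 0 < t := lt_of_le_of_ne ht (Ne.symm hne)
    have h1 : s = 1 - t := by linarith
    subst h1
    nlinarith
  have hs1 : s = 1 := by linarith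
  simpa [ht0, hs1] using ha

theorem facets_finite (hP : IsFullPolytope P) : (facets P).Finite := by
  obtain ⟨_, ⟨V, hV, rfl⟩, _⟩ := hP
  refine Set.Finite.of_finite_image (f := fun F => V ∩ F) (hV.finite_subsets.subset ?_) ?_
  · rintro _ ⟨F, -, rfl⟩
    exact Set.inter_subset_left
  · intro A hA B hB hAB
    rw [hA.1.eq_convexHull_inter, hB.1.eq_convexHull_inter]
    exact congrArg _ hAB

/-! ### Polytopes as intersections of facet half-spaces -/

/-- If a functional `l` is at most `1` on a finite set of vectors and is an extreme point of the set
of such functionals, then the vectors on which `l` equals `1` span the whole space. -/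
theorem span_eq_top_of_mem_extremePoints {W : Set (Space d)} (hW : W.Finite)
    {l : Space d →L[ℝ] ℝ}
    (hl : l ∈ Set.extremePoints ℝ {f : Space d →L[ℝ] ℝ | ∀ w ∈ W, f w ≤ 1}) :
    Submodule.span ℝ {w ∈ W | l w = 1} = ⊤ := by
  by_contra hne
  obtain ⟨e, he0, he⟩ := Submodule.exists_le_ker_of_lt_top _ (lt_top_iff_ne_top.2 hne)
  have he1 : ∀ w ∈ W, l w = 1 → e w = 0 := fun w hw h => he (Submodule.subset_span ⟨hw, h⟩)
  let f : Space d →L[ℝ] ℝ := LinearMap.toContinuousLinearMap e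
  have hf : ∀ w, f w = e w := fun _ => rfl
  -- A small multiple of `e` can be added to and subtracted from `l`.
  have hev : ∀ᶠ t : ℝ in nhds 0, ∀ w ∈ W, (l + t • f) w ≤ 1 := by
    rw [Set.Finite.eventually_all hW]
    intro w hw
    by_cases h : l w = 1
    · refine Filter.Eventually.of_forall fun t => ?_
      simp [hf, he1 w hw h, h]
    · have hlt : l w < 1 := lt_of_le_of_ne (hl.1 w hw) h
      have hc : Filter.Tendsto (fun t : ℝ => (l + t • f) w) (nhds 0) (nhds (l w)) := by
        have : Continuous fun t : ℝ => (l + t • f) w := by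
          simp only [add_apply, smul_apply, smul_eq_mul]; fun_prop
        simpa using this.tendsto 0
      exact (hc.eventually (gt_mem_nhds hlt)).mono fun _ h => h.le
  obtain ⟨ε, hε, hball⟩ := Metric.eventually_nhds_iff.1 hev
  have h1 : l + (ε / 2) • f ∈ {f : Space d →L[ℝ] ℝ | ∀ w ∈ W, f w ≤ 1} :=
    hball (by simp [abs_of_pos hε]; linarith)
  have h2 : l + (-(ε / 2)) • f ∈ {f : Space d →L[ℝ] ℝ | ∀ w ∈ W, f w ≤ 1} :=
    hball (by simp [abs_of_pos hε]; linarith)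
  have h3 : l + (ε / 2) • f = l := hl.2 h1 h2 ⟨1 / 2, 1 / 2, by norm_num, by norm_num, by norm_num,
    by module⟩
  have h4 : f = 0 := by
    rw [add_eq_left, smul_eq_zero] at h3
    exact h3.resolve_left (by positivity)
  exact he0 (LinearMap.ext fun x => by rw [← hf, h4]; simp)

/-- The set of functionals that are at most `1` on a set with a neighbourhood of the origin in its
convex hull is compact. -/
theorem isCompact_polar {W : Set (Space d)} (h0 : convexHull ℝ W ∈ nhds (0 : Space d)) :
    IsCompact {f : Space d →L[ℝ] ℝ | ∀ w ∈ W, f w ≤ 1} := by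
  have hprop : ProperSpace (Space d →L[ℝ] ℝ) := FiniteDimensional.proper ℝ _
  refine Metric.isCompact_of_isClosed_isBounded ?_ ?_
  · simp only [Set.ofPred_forall]
    refine isClosed_biInter fun w _ => isClosed_le ?_ continuous_const
    fun_prop
  · obtain ⟨r, hr, hball⟩ := Metric.nhds_basis_closedBall.mem_iff.1 h0
    refine (Metric.isBounded_iff_subset_closedBall 0).2 ⟨1 / r, fun f hf => ?_⟩
    have hle : ∀ y ∈ convexHull ℝ W, f y ≤ 1 := fun y hy =>
      (convexHull_min hf (convex_halfSpace_le f.toLinearMap.isLinear 1) hy : y ∈ {y | f y ≤ 1})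
    rw [mem_closedBall_zero_iff]
    refine ContinuousLinearMap.opNorm_bound_of_ball_bound hr 1 f fun y hy => ?_
    rw [Real.norm_eq_abs, abs_le]
    have h1 := hle y (hball hy)
    have h2 := hle (-y) (hball (by simpa using hy))
    rw [map_neg] at h2
    constructor <;> linarith

/-- A point outside a full-dimensional polytope is beyond some facet. The facet is given by an
extreme point of the polar polytope at which the point, as a functional, is maximal. -/
theorem exists_facet_beyond (hP : IsFullPolytope P) {x : Space d} (hx : x ∉ P) :
    ∃ F ∈ facets P, 0 < height P F x := by
  have hconv := hP.convex
  have hspan : affineSpan ℝ P = ⊤ :=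
    (AffineSubspace.affineSpan_eq_top_iff_vectorSpan_eq_top_of_nonempty ℝ _ _ hP.1).2
      hP.vectorSpan_eq_top
  obtain ⟨z, hz⟩ := hconv.interior_nonempty_iff_affineSpan_eq_top.2 hspan
  obtain ⟨V, hV, hPV⟩ := hP.2.1
  set W : Set (Space d) := (fun w => w - z) '' V with hWdef
  have hW : W.Finite := hV.image _
  have hmemW : ∀ y, y - z ∈ convexHull ℝ W ↔ y ∈ P := fun y => by
    have hWz : W = (AffineEquiv.constVAdd ℝ (Space d) (-z)).toAffineMap '' V := by
      ext; simp [hWdef, sub_eq_neg_add]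
    rw [hWz, ← AffineMap.image_convexHull, ← hPV]
    simp [sub_eq_neg_add]
  have h0 : convexHull ℝ W ∈ nhds (0 : Space d) := by
    have hc : Filter.Tendsto (fun y : Space d => y + z) (nhds 0) (nhds z) := by
      have : Continuous fun y : Space d => y + z := by fun_prop
      simpa using this.tendsto 0
    filter_upwards [hc.eventually_mem (mem_interior_iff_mem_nhds.1 hz)] with y hy
    have := (hmemW (y + z)).2 hy
    simpa using this
  have hK := isCompact_polar h0
  set K := {f : Space d →L[ℝ] ℝ | ∀ w ∈ W, f w ≤ 1} with hKdef
  -- A functional in `K` separates `x` from `P`.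
  obtain ⟨f, hfK, hfx⟩ : ∃ f ∈ K, 1 < f (x - z) := by
    have hclosed : IsClosed P := by
      rw [hPV]; exact hV.isClosed_convexHull ℝ
    obtain ⟨f, u, hfP, hfx⟩ := geometric_hahn_banach_closed_point hconv hclosed hx
    have hfz := hfP z (interior_subset hz)
    have hpos : 0 < u - f z := sub_pos.2 hfz
    refine ⟨(u - f z)⁻¹ • f, ?_, ?_⟩
    · rintro _ ⟨w, hw, rfl⟩
      have := hfP w (hPV ▸ subset_convexHull ℝ V hw)
      simp only [smul_apply, map_sub, smul_eq_mul, ← mul_sub]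
      rw [inv_mul_le_iff₀ hpos]
      linarith
    · simp only [smul_apply, map_sub, smul_eq_mul, ← mul_sub]
      rw [lt_inv_mul_iff₀ hpos]
      linarith
  let ev : (Space d →L[ℝ] ℝ) →L[ℝ] ℝ := (ContinuousLinearMap.apply ℝ ℝ) (x - z)
  obtain ⟨g, hgK, hg⟩ := hK.exists_isMaxOn ⟨f, hfK⟩ ev.continuous.continuousOn
  have hexp : IsExposed ℝ K (ev.toExposed K) :=
    ContinuousLinearMap.toExposed.isExposed
  obtain ⟨l, hl⟩ := (hexp.isCompact hK).extremePoints_nonempty ⟨g, hgK, hg⟩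
  have hlx : 1 < l (x - z) := hfx.trans_le (hl.1.2 f hfK)
  have hlK := hexp.isExtreme.extremePoints_subset_extremePoints hl
  have hl1 := span_eq_top_of_mem_extremePoints hW hlK
  have hlP : ∀ y ∈ P, l y ≤ 1 + l z := fun y hy => by
    have : l (y - z) ≤ 1 := (convexHull_min hlK.1 (convex_halfSpace_le l.toLinearMap.isLinear 1)
      ((hmemW y).2 hy) : y - z ∈ {y | l y ≤ 1})
    rw [map_sub] at this
    linarith
  have hne : l ≠ 0 := by
    rintro rfl
    simp at hlx
    linarith
  set F := {y ∈ P | l y = 1 + l z} with hFdef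
  have hWF : ∀ w ∈ W, l w = 1 → w + z ∈ F := fun w hw h =>
    ⟨(hmemW _).1 (by simpa using subset_convexHull ℝ W hw), by rw [map_add, h]⟩
  obtain ⟨w₀, hw₀⟩ : {w ∈ W | l w = 1}.Nonempty := by
    rw [Set.nonempty_iff_ne_empty]
    intro h
    rw [h, Submodule.span_empty] at hl1
    apply hne
    ext y
    have : y ∈ (⊥ : Submodule ℝ (Space d)) := hl1 ▸ Submodule.mem_top
    simp [(Submodule.mem_bot ℝ).1 this]
  have hF : F ∈ facets P := by
    refine ⟨isFace_of_functional hlP, ⟨_, hWF w₀ hw₀.1 hw₀.2⟩, ?_⟩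
    have h1 : finrank ℝ (vectorSpan ℝ F) ≤ finrank ℝ (LinearMap.ker (l : Space d →ₗ[ℝ] ℝ)) :=
      Submodule.finrank_mono (vectorSpan_le_ker fun y hy => hy.2)
    have h2 := finrank_ker_add_one hne
    have h3 : (⊤ : Submodule ℝ (Space d)) ≤ vectorSpan ℝ F ⊔ Submodule.span ℝ {w₀} := by
      rw [← hl1, Submodule.span_le]
      rintro w ⟨hw, hlw⟩
      have h4 : w - w₀ ∈ vectorSpan ℝ F := by
        have := vsub_mem_vectorSpan ℝ (hWF w hw hlw) (hWF w₀ hw₀.1 hw₀.2)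
        simpa using this
      rw [← sub_add_cancel w w₀]
      exact Submodule.add_mem_sup h4 (Submodule.mem_span_singleton_self w₀)
    have h5 := Submodule.finrank_mono h3
    rw [finrank_top, finrank_euclideanSpace_fin] at h5
    have h6 := Submodule.finrank_add_le_finrank_add_finrank (vectorSpan ℝ F)
      (Submodule.span ℝ {w₀})
    have h7 : finrank ℝ (Submodule.span ℝ {w₀}) ≤ 1 := by
      simpa using finrank_span_le_card (R := ℝ) {w₀}
    change finrank ℝ (vectorSpan ℝ F) + 1 = d
    omega
  refine ⟨F, hF, (mem_negSide_iff hP hF).1 ⟨-l, -(1 + l z), fun y hy => ?_, fun y hy => ?_, ?_⟩⟩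
  · simp [hy.2]
  · have := hlP y hy
    simp; linarith
  · rw [map_sub] at hlx
    simp; linarith

theorem mem_of_forall_height_nonpos (hP : IsFullPolytope P) {x : Space d}
    (h : ∀ F ∈ facets P, height P F x ≤ 0) : x ∈ P := by
  by_contra hx
  obtain ⟨F, hF, hlt⟩ := exists_facet_beyond hP hx
  exact (h F hF).not_gt hlt

/-! ### The facets through a face -/

theorem height_add_smul (P F : Set (Space d)) (x u : Space d) (t : ℝ) :
    height P F (x + t • u) = height P F x + t * normal P F u := by
  simp [height]; ring

theorem IsFace.inter {A B : Set (Space d)} (hA : IsFace P A) (hB : IsFace P B) :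
    IsFace P (A ∩ B) := IsExposed.inter hA hB

/-- A nonempty face contains a point that lies only on those facets that contain the face. -/
theorem IsFace.exists_forall_height_neg (hP : IsFullPolytope P) (hG : IsFace P G)
    (hne : G.Nonempty) : ∃ g ∈ G, ∀ F ∈ facets P, ¬ G ⊆ F → height P F g < 0 := by
  have hconv : Convex ℝ G := hG.convex hP.convex
  have key : ∀ T : Set (Set (Space d)), T.Finite → T ⊆ {F ∈ facets P | ¬ G ⊆ F} →
      ∃ g ∈ G, ∀ F ∈ T, height P F g < 0 := by
    intro T hT
    induction T, hT using Set.Finite.induction_on with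
    | empty => exact fun _ => ⟨_, hne.some_mem, by simp⟩
    | @insert A T _ _ ih =>
      intro hsub
      obtain ⟨g, hg, hgT⟩ := ih ((Set.subset_insert A T).trans hsub)
      obtain ⟨hA, hGA⟩ := hsub (Set.mem_insert A T)
      obtain ⟨a, ha, haA⟩ := Set.not_subset.1 hGA
      have hmid : ∀ F, height P F ((1 / 2 : ℝ) • g + (1 / 2 : ℝ) • a) =
          (height P F g + height P F a) / 2 := fun F => by simp [height]; ring
      refine ⟨(1 / 2 : ℝ) • g + (1 / 2 : ℝ) • a,
        hconv hg ha (by norm_num) (by norm_num) (by norm_num), ?_⟩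
      rintro F (rfl | hF)
      · have h1 := height_nonpos hA (hG.subset hg)
        have h2 := height_neg hA (hG.subset ha) haA
        rw [hmid]; linarith
      · have h1 := hgT F hF
        have h2 := height_nonpos (hsub (Set.mem_insert_of_mem A hF)).1 (hG.subset ha)
        rw [hmid]; linarith
  obtain ⟨g, hg, h⟩ := key _ ((facets_finite hP).subset (Set.sep_subset _ _)) subset_rfl
  exact ⟨g, hg, fun F hF hGF => h F ⟨hF, hGF⟩⟩

/-- The tangent cone of a polytope at a relative interior point of a face is cut out by the facets
containing the face. -/
theorem IsFace.exists_forall_add_smul_mem (hP : IsFullPolytope P) (hG : IsFace P G)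
    (hne : G.Nonempty) : ∃ g ∈ G, ∀ u : Space d,
      (∀ F ∈ facets P, G ⊆ F → normal P F u ≤ 0) → ∃ t > (0 : ℝ), g + t • u ∈ P := by
  obtain ⟨g, hg, hneg⟩ := hG.exists_forall_height_neg hP hne
  refine ⟨g, hg, fun u hu => ?_⟩
  have hev : ∀ᶠ t : ℝ in nhdsWithin 0 (Set.Ioi 0), ∀ F ∈ facets P, height P F (g + t • u) ≤ 0 := by
    rw [Set.Finite.eventually_all (facets_finite hP)]
    intro F hF
    by_cases hGF : G ⊆ F
    · filter_upwards [self_mem_nhdsWithin] with t ht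
      rw [height_add_smul, height_eq_zero hF (hGF hg), zero_add]
      exact mul_nonpos_of_nonneg_of_nonpos (le_of_lt ht) (hu F hF hGF)
    · have hc : Filter.Tendsto (fun t : ℝ => height P F (g + t • u)) (nhds 0)
          (nhds (height P F g)) := by
        have : Continuous fun t : ℝ => height P F (g + t • u) := by
          simp only [height_add_smul]; fun_prop
        simpa using this.tendsto 0
      exact nhdsWithin_le_nhds
        ((hc.eventually (gt_mem_nhds (hneg F hF hGF))).mono fun _ h => h.le)
  obtain ⟨t, ht, htpos⟩ := (hev.and self_mem_nhdsWithin).exists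
  exact ⟨t, htpos, mem_of_forall_height_nonpos hP ht⟩

/-- The linear span of a face is cut out by the normals of the facets containing it. -/
theorem IsFace.mem_vectorSpan (hP : IsFullPolytope P) (hG : IsFace P G) (hne : G.Nonempty)
    {u : Space d} (hu : ∀ F ∈ facets P, G ⊆ F → normal P F u = 0) : u ∈ vectorSpan ℝ G := by
  obtain ⟨g, hg, h⟩ := hG.exists_forall_add_smul_mem hP hne
  obtain ⟨s, hs, hsP⟩ := h u fun F hF hGF => (hu F hF hGF).le
  obtain ⟨t, ht, htP⟩ := h (-u) fun F hF hGF => by simp [hu F hF hGF]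
  have hsG : g + s • u ∈ G := by
    refine hG.isExtreme.left_mem_of_mem_openSegment hsP htP hg
      ⟨t / (s + t), s / (s + t), by positivity, by positivity, by field_simp; ring, ?_⟩
    have hst : s + t ≠ 0 := by positivity
    have h1 : t / (s + t) + s / (s + t) = 1 := by field_simp; ring
    have h2 : t / (s + t) * s - s / (s + t) * t = 0 := by field_simp; ring
    calc _ = (t / (s + t) + s / (s + t)) • g + (t / (s + t) * s - s / (s + t) * t) • u := by module
      _ = g := by rw [h1, h2]; simp
  have h1 : s • u ∈ vectorSpan ℝ G := by
    simpa using vsub_mem_vectorSpan ℝ hsG hg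
  exact (Submodule.smul_mem_iff _ hs.ne').1 h1

theorem facets_containing_finite (hP : IsFullPolytope P) (G : Set (Space d)) :
    {F | F ∈ facets P ∧ G ⊆ F}.Finite :=
  (facets_finite hP).subset (Set.sep_subset _ _)

/-- A face of codimension `k` lies in at least `k` facets. -/
theorem IsFace.le_dim_add_fdeg (hP : IsFullPolytope P) (hG : IsFace P G) (hne : G.Nonempty) :
    d ≤ dim G + fdeg P G := by
  have := (facets_containing_finite hP G).fintype
  let Φ : Space d →ₗ[ℝ] ({F | F ∈ facets P ∧ G ⊆ F} → ℝ) :=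
    LinearMap.pi fun F => (normal P F.1 : Space d →ₗ[ℝ] ℝ)
  have hker : LinearMap.ker Φ ≤ vectorSpan ℝ G := fun u hu =>
    hG.mem_vectorSpan hP hne fun F hF hGF => congrFun (LinearMap.mem_ker.1 hu) ⟨F, hF, hGF⟩
  have h1 := Φ.finrank_range_add_finrank_ker
  have h2 := Submodule.finrank_mono hker
  have h3 := Submodule.finrank_le (LinearMap.range Φ)
  rw [finrank_fintype_fun_eq_card, ← Nat.card_eq_fintype_card, Nat.card_coe_set_eq] at h3
  rw [finrank_euclideanSpace_fin] at h1
  unfold dim fdeg numContaining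
  omega

theorem facet_not_subset {A B : Set (Space d)} (hA : A ∈ facets P) (hB : B ∈ facets P)
    (hAB : A ≠ B) : ¬ A ⊆ B := fun h =>
  hAB (hA.1.eq_of_subset_of_dim_le hA.2.1 hB.1 h (by have := hA.2.2; have := hB.2.2; omega))

theorem dim_inter_facets {A B : Set (Space d)} (hA : A ∈ facets P) (hB : B ∈ facets P)
    (hAB : A ≠ B) (hne : (A ∩ B).Nonempty) : dim (A ∩ B) + 2 ≤ d := by
  have h := (hA.1.inter hB.1).dim_lt_of_ssubset hne hA.1
    (Set.inter_subset_left.ssubset_of_ne fun h => facet_not_subset hA hB hAB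
      (Set.inter_eq_left.1 h))
  have := hA.2.2
  omega

/-- Modulo `U`, the vectors `x i` span at most a plane, so the matrix of the values `f i (x j)` has
rank at most two; but a `3 × 3` matrix with zero diagonal and negative entries off the diagonal is
nonsingular. -/
theorem false_of_signs {U W : Submodule ℝ (Space d)} (hUW : U ≤ W)
    (hdim : finrank ℝ W ≤ finrank ℝ U + 2) {f : Fin 3 → Space d →L[ℝ] ℝ} {x : Fin 3 → Space d}
    (hxW : ∀ i, x i ∈ W) (hU : ∀ i, ∀ u ∈ U, f i u = 0) (hdiag : ∀ i, f i (x i) = 0)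
    (hoff : ∀ i j, i ≠ j → f i (x j) < 0) : False := by
  let Φ : Space d →ₗ[ℝ] (Fin 3 → ℝ) := LinearMap.pi fun i => (f i : Space d →ₗ[ℝ] ℝ)
  have h1 := (Φ.domRestrict W).finrank_range_add_finrank_ker
  have h2 : finrank ℝ U ≤ finrank ℝ (LinearMap.ker (Φ.domRestrict W)) := by
    rw [← (Submodule.submoduleOfEquivOfLe hUW).finrank_eq]
    refine Submodule.finrank_mono fun u hu => ?_
    ext i
    exact hU i u.1 hu
  have hdep : ¬ LinearIndependent ℝ fun j => Φ (x j) := by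
    intro hli
    have h3 := finrank_span_eq_card hli
    have h4 : Submodule.span ℝ (Set.range fun j => Φ (x j)) ≤
        LinearMap.range (Φ.domRestrict W) := by
      rw [Submodule.span_le]
      rintro _ ⟨j, rfl⟩
      exact ⟨⟨x j, hxW j⟩, rfl⟩
    have h5 := Submodule.finrank_mono h4
    simp only [Fintype.card_fin] at h3
    omega
  obtain ⟨g, hg, hne⟩ := Fintype.not_linearIndependent_iff.1 hdep
  have heq : ∀ i, g 0 * f i (x 0) + g 1 * f i (x 1) + g 2 * f i (x 2) = 0 := fun i => by
    have := congrFun hg i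
    simpa [Fin.sum_univ_three, Φ] using this
  have e0 := heq 0
  have e1 := heq 1
  have e2 := heq 2
  rw [hdiag] at e0 e1 e2
  have a01 := hoff 0 1 (by decide)
  have a02 := hoff 0 2 (by decide)
  have a10 := hoff 1 0 (by decide)
  have a12 := hoff 1 2 (by decide)
  have a20 := hoff 2 0 (by decide)
  have a21 := hoff 2 1 (by decide)
  rcases lt_trichotomy (g 0) 0 with h0 | h0 | h0
  · have k2 : 0 < g 2 := by by_contra! h; nlinarith
    have k1 : 0 < g 1 := by by_contra! h; nlinarith
    nlinarith
  · have k2 : g 2 = 0 := by simpa [h0, a12.ne] using e1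
    have k1 : g 1 = 0 := by simpa [h0, a21.ne] using e2
    obtain ⟨i, hi⟩ := hne
    fin_cases i
    exacts [hi h0, hi k1, hi k2]
  · have k2 : g 2 < 0 := by by_contra! h; nlinarith
    have k1 : g 1 < 0 := by by_contra! h; nlinarith
    nlinarith

theorem exists_injective_of_two_lt_ncard {α : Type*} {s : Set α} (hs : s.Finite)
    (h : 2 < s.ncard) : ∃ A : Fin 3 → α, A.Injective ∧ ∀ i, A i ∈ s := by
  obtain ⟨a, b, c, ha, hb, hc, hab, hac, hbc⟩ := (Set.two_lt_ncard_iff hs).1 h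
  refine ⟨![a, b, c], ?_, ?_⟩
  · intro i j
    fin_cases i <;> fin_cases j <;> simp [hab, hac, hbc, hab.symm, hac.symm, hbc.symm]
  · intro i
    fin_cases i
    exacts [ha, hb, hc]

/-- If `G` has codimension two in `B`, there are no three facets that meet `B` in more than `G`,
but pairwise only in `G`. -/
theorem false_of_three_facets (hG : G.Nonempty) {B : Set (Space d)} (hGB : G ⊆ B)
    (hBP : B ⊆ P) (hdim : dim B ≤ dim G + 2) {A : Fin 3 → Set (Space d)}
    (hA : ∀ i, A i ∈ facets P) (hGA : ∀ i, G ⊆ A i) (hBA : ∀ i, ¬ B ∩ A i ⊆ G)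
    (hinter : ∀ i j, i ≠ j → B ∩ A i ∩ A j ⊆ G) : False := by
  choose x hx hxG using fun i => Set.not_subset.1 (hBA i)
  obtain ⟨g, hg⟩ := hG
  have hn : ∀ i j, normal P (A i) (x j - g) = height P (A i) (x j) := fun i j => by
    rw [← height_sub_height, height_eq_zero (hA i) (hGA i hg), sub_zero]
  refine false_of_signs (vectorSpan_mono ℝ hGB) hdim (f := fun i => normal P (A i))
    (x := fun i => x i - g) (fun i => vsub_mem_vectorSpan ℝ (hx i).1 (hGB hg))
    (fun i u hu => vectorSpan_le_ker_normal (hA i) (hGA i) hu) (fun i => ?_) fun i j hij => ?_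
  · rw [hn, height_eq_zero (hA i) (hx i).2]
  · rw [hn]
    exact height_neg (hA i) (hBP (hx j).1) fun h => hxG j (hinter j i hij.symm ⟨hx j, h⟩)

theorem inter_eq_ridge {A B : Set (Space d)} (hR : IsRidge P R) (hA : A ∈ facets P)
    (hB : B ∈ facets P) (hAB : A ≠ B) (hRA : R ⊆ A) (hRB : R ⊆ B) : R = A ∩ B := by
  have hsub := Set.subset_inter hRA hRB
  refine hR.1.eq_of_subset_of_dim_le hR.2.1 (hA.1.inter hB.1) hsub ?_
  have := dim_inter_facets hA hB hAB (hR.2.1.mono hsub)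
  have := hR.2.2
  omega

/-- A ridge lies in exactly two facets. -/
theorem IsRidge.fdeg_eq_two (hP : IsFullPolytope P) (hR : IsRidge P R) : fdeg P R = 2 := by
  have h1 := hR.1.le_dim_add_fdeg hP hR.2.1
  have h2 := hR.2.2
  refine le_antisymm ?_ (by omega)
  by_contra! h
  obtain ⟨A, hinj, hA⟩ := exists_injective_of_two_lt_ncard (facets_containing_finite hP R) h
  refine false_of_three_facets hR.2.1 hR.1.subset subset_rfl (by have := hP.2.2; omega)
    (fun i => (hA i).1) (fun i => (hA i).2) (fun i hi => ?_) fun i j hij x hx => ?_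
  · rw [Set.inter_eq_right.2 (hA i).1.1.subset] at hi
    have := (hA i).1.2.2
    rw [hi.antisymm (hA i).2] at this
    omega
  · rw [inter_eq_ridge hR (hA i).1 (hA j).1 (hinj.ne hij) (hA i).2 (hA j).2]
    exact ⟨hx.1.2, hx.2⟩

/-- Among the facets adjacent to `S`, at most two contain a given subridge in `S`. -/
theorem numContaining_le_two (hP : IsFullPolytope P) (hS : S ∈ facets P)
    {𝓕 : Set (Set (Space d))} (h𝓕 : 𝓕 ⊆ adj P S) (hG : IsSubridge P G) (hGS : G ⊆ S) :
    numContaining 𝓕 G ≤ 2 := by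
  by_contra! h
  have hfin : {F | F ∈ 𝓕 ∧ G ⊆ F}.Finite :=
    (facets_containing_finite hP G).subset fun F hF => ⟨(h𝓕 hF.1).1, hF.2⟩
  obtain ⟨A, hinj, hA⟩ := exists_injective_of_two_lt_ncard hfin h
  have hdG := hG.2.2
  have hridge : ∀ i, IsRidge P (S ∩ A i) := fun i => (h𝓕 (hA i).1).2.2
  refine false_of_three_facets hG.2.1 hGS hS.1.subset (by have := hS.2.2; omega)
    (fun i => (h𝓕 (hA i).1).1) (fun i => (hA i).2) (fun i hi => ?_) fun i j hij x hx => ?_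
  · have := (hridge i).2.2
    rw [hi.antisymm (Set.subset_inter hGS (hA i).2)] at this
    omega
  · -- If the two facets and `S` met in more than `G`, they would share a ridge.
    by_contra hxG
    have hf : IsFace P (S ∩ A i ∩ A j) := (hridge i).1.inter (h𝓕 (hA j).1).1.1
    have hGs : G ⊂ S ∩ A i ∩ A j := Set.ssubset_iff_subset_ne.2
      ⟨Set.subset_inter (Set.subset_inter hGS (hA i).2) (hA j).2, fun h => hxG (h ▸ hx)⟩
    have h1 := hG.1.dim_lt_of_ssubset hG.2.1 hf hGs
    have h2 : S ∩ A i ∩ A j = S ∩ A i :=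
      hf.eq_of_subset_of_dim_le (hG.2.1.mono hGs.subset) (hridge i).1 Set.inter_subset_left (by
        have := (hridge i).2.2; omega)
    have h3 := (hridge i).fdeg_eq_two hP
    have h4 : 2 < fdeg P (S ∩ A i) :=
      (Set.two_lt_ncard_iff (facets_containing_finite hP _)).2 ⟨S, A i, A j,
        ⟨hS, Set.inter_subset_left⟩, ⟨(h𝓕 (hA i).1).1, Set.inter_subset_right⟩,
        ⟨(h𝓕 (hA j).1).1, Set.inter_eq_left.1 h2⟩, (h𝓕 (hA i).1).2.1.symm,
        (h𝓕 (hA j).1).2.1.symm, hinj.ne hij⟩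
    omega

/-! ### Adding a point to a polytope -/

theorem IsFullPolytope.convexHull_union_singleton (hP : IsFullPolytope P) (v : Space d) :
    IsFullPolytope (convexHull ℝ (P ∪ {v})) := by
  have hsub : P ⊆ convexHull ℝ (P ∪ {v}) := Set.subset_union_left.trans (subset_convexHull ℝ _)
  refine ⟨hP.1.mono hsub, ?_, ?_⟩
  · obtain ⟨V, hV, rfl⟩ := hP.2.1
    exact ⟨V ∪ {v}, hV.union (Set.finite_singleton v), convexHull_convexHull_union_left V {v}⟩
  · have h : vectorSpan ℝ (convexHull ℝ (P ∪ {v})) = ⊤ :=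
      top_unique (hP.vectorSpan_eq_top ▸ vectorSpan_mono ℝ hsub)
    rw [dim, h, finrank_top, finrank_euclideanSpace_fin]

theorem le_on_convexHull_union {l : Space d →L[ℝ] ℝ} {m : ℝ} (hl : ∀ x ∈ P, l x ≤ m)
    (hv : l v ≤ m) : ∀ x ∈ convexHull ℝ (P ∪ {v}), l x ≤ m := by
  have : P ∪ {v} ⊆ {x | l x ≤ m} := by
    rintro x (hx | rfl)
    exacts [hl x hx, hv]
  exact fun x hx => convexHull_min this (convex_halfSpace_le l.toLinearMap.isLinear m) hx

theorem face_subset_of_notMem (hP : IsFullPolytope P) (hF : IsFace (convexHull ℝ (P ∪ {v})) F)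
    (hv : v ∉ F) : F ⊆ P := by
  rw [hF.eq_convexHull_inter]
  refine convexHull_min ?_ hP.convex
  rintro x ⟨hx | rfl, hxF⟩
  exacts [hx, (hv hxF).elim]

theorem isFace_convexHull_union (hP : IsFullPolytope P) {l : Space d →L[ℝ] ℝ} {m : ℝ}
    (hl : ∀ x ∈ P, l x ≤ m) (hv : l v < m) :
    IsFace (convexHull ℝ (P ∪ {v})) {x ∈ P | l x = m} := by
  have hf := isFace_of_functional (le_on_convexHull_union hl hv.le)
  have hsub := face_subset_of_notMem hP hf fun h => hv.ne h.2
  convert hf using 1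
  exact Set.Subset.antisymm
    (fun x hx => ⟨subset_convexHull ℝ _ (Set.subset_union_left hx.1), hx.2⟩)
    fun x hx => ⟨hsub hx, hx.2⟩

theorem mem_facets_convexHull_union (hP : IsFullPolytope P) (hF : F ∈ facets P)
    (hv : height P F v < 0) : F ∈ facets (convexHull ℝ (P ∪ {v})) := by
  refine ⟨?_, hF.2⟩
  have h := isFace_convexHull_union hP (l := normal P F) (m := (supporting P F).2)
    (fun x hx => sub_nonpos.1 (height_nonpos hF hx)) (sub_neg.1 hv)
  convert h using 1
  ext x
  rw [mem_facet_iff hF]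
  simp [height, sub_eq_zero]

/-- A functional exposing a face `G` still does so after tilting it towards the normal of a facet
through `G`. -/
theorem exists_tilted_functional {l : Space d →L[ℝ] ℝ} {m : ℝ} (hGl : G = {x ∈ P | l x = m})
    (hl : ∀ x ∈ P, l x ≤ m) (hF : F ∈ facets P) (hGF : G ⊆ F) {M : ℝ} (hM : 0 ≤ M) :
    ∃ (l' : Space d →L[ℝ] ℝ) (m' : ℝ), G = {x ∈ P | l' x = m'} ∧ (∀ x ∈ P, l' x ≤ m') ∧
      ∀ x, l' x - m' = l x - m + M * height P F x := by
  have hval : ∀ x, (l + M • normal P F) x - (m + M * (supporting P F).2) =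
      l x - m + M * height P F x := fun x => by simp [height]; ring
  refine ⟨l + M • normal P F, m + M * (supporting P F).2, ?_, fun x hx => ?_, hval⟩
  · ext x
    rw [Set.mem_ofPred_eq, ← sub_eq_zero, hval]
    constructor
    · intro hx
      have h1 := height_eq_zero hF (hGF hx)
      rw [hGl] at hx
      exact ⟨hx.1, by rw [h1, hx.2]; ring⟩
    · rintro ⟨hx, hx0⟩
      have h1 := hl x hx
      have h2 := mul_nonpos_of_nonneg_of_nonpos hM (height_nonpos hF hx)
      rw [hGl]
      exact ⟨hx, by linarith⟩
  · rw [← sub_nonpos, hval]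
    have := hl x hx
    have := mul_nonpos_of_nonneg_of_nonpos hM (height_nonpos hF hx)
    linarith

/-- A face of `P` in a facet that the new point is beneath remains a face. -/
theorem IsFace.convexHull_union (hP : IsFullPolytope P) (hG : IsFace P G) (hne : G.Nonempty)
    (hF : F ∈ facets P) (hGF : G ⊆ F) (hv : height P F v < 0) :
    IsFace (convexHull ℝ (P ∪ {v})) G := by
  obtain ⟨l, m, hGl, hl⟩ := hG.exists_functional hne
  -- Tilt the functional `l` until it is less than its maximum at `v`.
  obtain ⟨M, hM, hMv⟩ : ∃ M : ℝ, 0 ≤ M ∧ l v - m + M * height P F v < 0 := by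
    refine ⟨(|l v - m| + 1) / -height P F v, by have := neg_pos.2 hv; positivity, ?_⟩
    rw [div_mul_eq_mul_div, div_neg, mul_div_assoc, div_self hv.ne]
    linarith [le_abs_self (l v - m)]
  obtain ⟨l', m', hGl', hl', hval⟩ := exists_tilted_functional hGl hl hF hGF hM
  rw [hGl']
  exact isFace_convexHull_union hP hl' (by rw [← sub_neg, hval]; exact hMv)

theorem facet_of_notMem (hP : IsFullPolytope P) (hF : F ∈ facets (convexHull ℝ (P ∪ {v})))
    (hv : v ∉ F) : F ∈ facets P ∧ height P F v < 0 := by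
  have hsub : P ⊆ convexHull ℝ (P ∪ {v}) := Set.subset_union_left.trans (subset_convexHull ℝ _)
  have hFP : F ∈ facets P :=
    ⟨IsExposed.mono hF.1 hsub (face_subset_of_notMem hP hF.1 hv), hF.2⟩
  have hvQ : v ∈ convexHull ℝ (P ∪ {v}) := subset_convexHull ℝ _ (Or.inr rfl)
  obtain ⟨l, c, hlF, hlP, hlv⟩ :=
    (mem_posSide_iff (hP.convexHull_union_singleton v) hF).2 (height_neg hF hvQ hv)
  exact ⟨hFP, (mem_posSide_iff hP hFP).1 ⟨l, c, hlF, fun y hy => hlP y (hsub hy), hlv⟩⟩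

/-- If `v` is beneath a facet through the face `G` and beyond another one, then some functional
exposing `G` is also maximal at `v`. -/
theorem exists_functional_on_join (hG : IsFace P G) (hne : G.Nonempty) {A B : Set (Space d)}
    (hA : A ∈ facets P) (hGA : G ⊆ A) (hAv : height P A v < 0) (hB : B ∈ facets P) (hGB : G ⊆ B)
    (hBv : 0 < height P B v) :
    ∃ (l : Space d →L[ℝ] ℝ) (m : ℝ), G = {x ∈ P | l x = m} ∧ (∀ x ∈ P, l x ≤ m) ∧ l v = m := by
  obtain ⟨l, m, hGl, hl⟩ := hG.exists_functional hne
  -- Depending on the sign of `l v - m`, tilt `l` towards the normal of `A` or of `B`.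
  obtain ⟨C, M, hC, hGC, hM, hMv⟩ : ∃ (C : Set (Space d)) (M : ℝ), C ∈ facets P ∧ G ⊆ C ∧ 0 ≤ M ∧
      l v - m + M * height P C v = 0 := by
    rcases le_total 0 (l v - m) with h | h
    · refine ⟨A, (l v - m) / -height P A v, hA, hGA, div_nonneg h (neg_pos.2 hAv).le, ?_⟩
      rw [div_mul_eq_mul_div, div_neg, mul_div_assoc, div_self hAv.ne]
      ring
    · refine ⟨B, -(l v - m) / height P B v, hB, hGB, div_nonneg (neg_nonneg.2 h) hBv.le, ?_⟩
      rw [div_mul_eq_mul_div, mul_div_assoc, div_self hBv.ne']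
      ring
  obtain ⟨l', m', hGl', hl', hval⟩ := exists_tilted_functional hGl hl hC hGC hM
  exact ⟨l', m', hGl', hl', by rw [← sub_eq_zero, hval, hMv]⟩

/-- If the new point is beneath a facet through the subridge `G` and beyond another one, then
the convex hull of `G` and the new point is a ridge. -/
theorem isRidge_join (hG : IsSubridge P G) {A B : Set (Space d)}
    (hA : A ∈ facets P) (hGA : G ⊆ A) (hAv : height P A v < 0) (hB : B ∈ facets P) (hGB : G ⊆ B)
    (hBv : 0 < height P B v) :
    IsRidge (convexHull ℝ (P ∪ {v})) (convexHull ℝ (insert v G)) := by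
  obtain ⟨l, m, hGl, hl, hlv⟩ := exists_functional_on_join hG.1 hG.2.1 hA hGA hAv hB hGB hBv
  refine ⟨?_, (Set.insert_nonempty v G).convexHull, ?_⟩
  · have hf := isFace_of_functional (le_on_convexHull_union hl hlv.le)
    convert hf using 1
    rw [hf.eq_convexHull_inter]
    congr 1
    ext x
    constructor
    · rintro (rfl | hx)
      · exact ⟨Or.inr rfl, subset_convexHull ℝ _ (Or.inr rfl), hlv⟩
      · rw [hGl] at hx
        exact ⟨Or.inl hx.1, subset_convexHull ℝ _ (Or.inl hx.1), hx.2⟩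
    · rintro ⟨hx | rfl, -, hxm⟩
      · exact Or.inr (hGl ▸ ⟨hx, hxm⟩)
      · exact Or.inl rfl
  · obtain ⟨g, hg⟩ := hG.2.1
    have hspan : vectorSpan ℝ (convexHull ℝ (insert v G)) = vectorSpan ℝ (insert v G) := by
      rw [← direction_affineSpan, affineSpan_convexHull, direction_affineSpan]
    have hlt : vectorSpan ℝ G < vectorSpan ℝ (insert v G) := by
      refine lt_of_le_of_ne (vectorSpan_mono ℝ (Set.subset_insert v G)) fun h => ?_
      have h1 : v - g ∈ vectorSpan ℝ G :=
        h ▸ vsub_mem_vectorSpan ℝ (Set.mem_insert v G) (Set.mem_insert_of_mem v hg)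
      have h2 : normal P B (v - g) = 0 := vectorSpan_le_ker_normal hB hGB h1
      rw [← height_sub_height, height_eq_zero hB (hGB hg)] at h2
      linarith
    have h1 := Submodule.finrank_lt_finrank_of_lt hlt
    have h2 := finrank_vectorSpan_insert_le_set ℝ G v
    have h3 : finrank ℝ (vectorSpan ℝ G) + 3 = d := hG.2.2
    rw [dim, hspan]
    omega

/-- The facets through `G` after adding `v` are the old ones that `v` is beneath, and the two
through the ridge spanned by `G` and `v`. -/
theorem fdeg_convexHull_union (hP : IsFullPolytope P) (hG : IsSubridge P G) {A B : Set (Space d)}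
    (hA : A ∈ facets P) (hGA : G ⊆ A) (hAv : height P A v < 0) (hB : B ∈ facets P) (hGB : G ⊆ B)
    (hBv : 0 < height P B v) :
    fdeg (convexHull ℝ (P ∪ {v})) G = numContaining {F ∈ facets P | height P F v < 0} G + 2 := by
  have hQ := hP.convexHull_union_singleton v
  have hR := isRidge_join hG hA hGA hAv hB hGB hBv
  have hvP : v ∉ P := fun h => (height_nonpos hB h).not_gt hBv
  rw [← hR.fdeg_eq_two hQ]
  unfold fdeg numContaining
  rw [← Set.ncard_union_eq ?_ ((facets_finite hP).subset fun F hF => hF.1.1)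
    (facets_containing_finite hQ _)]
  · congr 1
    ext F
    constructor
    · rintro ⟨hF, hGF⟩
      by_cases hv : v ∈ F
      · exact Or.inr ⟨hF, convexHull_min (Set.insert_subset hv hGF) (hF.1.convex hQ.convex)⟩
      · exact Or.inl ⟨facet_of_notMem hP hF hv, hGF⟩
    · rintro (⟨⟨hF, hv⟩, hGF⟩ | ⟨hF, hRF⟩)
      · exact ⟨mem_facets_convexHull_union hP hF hv, hGF⟩
      · exact ⟨hF, (Set.subset_insert v G).trans ((subset_convexHull ℝ _).trans hRF)⟩
  · rw [Set.disjoint_left]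
    rintro F ⟨⟨hF, -⟩, -⟩ ⟨-, hRF⟩
    exact hvP (hF.1.subset (hRF (subset_convexHull ℝ _ (Set.mem_insert v G))))

/-- A face is destroyed if the new point is beneath none of the facets through it: extending the
segment from the new point to a relative interior point of the face leads into the polytope. -/
theorem not_isFace_convexHull_union (hP : IsFullPolytope P) (hG : IsFace P G) (hne : G.Nonempty)
    (hv : v ∉ P) (h : ∀ F ∈ facets P, G ⊆ F → 0 ≤ height P F v) :
    ¬ IsFace (convexHull ℝ (P ∪ {v})) G := by
  intro hGQ
  obtain ⟨g, hg, hcone⟩ := hG.exists_forall_add_smul_mem hP hne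
  obtain ⟨t, ht, hmem⟩ := hcone (g - v) fun F hF hGF => by
    rw [← height_sub_height, height_eq_zero hF (hGF hg)]
    linarith [h F hF hGF]
  have hseg : g ∈ openSegment ℝ v (g + t • (g - v)) := by
    refine ⟨t / (1 + t), 1 / (1 + t), by positivity, by positivity, by field_simp; ring, ?_⟩
    have h1 : t / (1 + t) = 1 - 1 / (1 + t) := by field_simp; ring
    have h2 : 1 / (1 + t) * t = 1 - 1 / (1 + t) := by field_simp; ring
    rw [smul_add, smul_smul, h2, h1]
    module
  exact hv (hG.subset (hGQ.isExtreme.left_mem_of_mem_openSegment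
    (subset_convexHull ℝ _ (Or.inr rfl)) (subset_convexHull ℝ _ (Or.inl hmem)) hg hseg))

/-! ### Pseudo-stackings -/

variable {𝓕 𝓝 : Set (Set (Space d))}

theorem height_pos_of_mem_region (hP : IsFullPolytope P) (hF : F ∈ facets P)
    (hv : v ∈ region P S 𝓕 𝓝) (h : F ∈ 𝓝 ∪ {S}) : 0 < height P F v :=
  (mem_negSide_iff hP hF).1 (Set.mem_iInter₂.1 hv.2 F h)

theorem height_eq_zero_of_mem_region (hF : F ∈ facets P)
    (hv : v ∈ region P S 𝓕 𝓝) (h : F ∈ 𝓕) : height P F v = 0 :=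
  height_eq_zero_of_mem_hyp hF (Set.mem_iInter₂.1 hv.1.2 F h)

theorem height_neg_of_mem_region (hP : IsFullPolytope P) (hF : F ∈ facets P)
    (hv : v ∈ region P S 𝓕 𝓝) (h : F ∉ 𝓕 ∪ 𝓝 ∪ {S}) : height P F v < 0 :=
  (mem_posSide_iff hP hF).1 (Set.mem_iInter₂.1 hv.1.1 F ⟨hF, h⟩)

theorem numContaining_union {𝓐 𝓑 : Set (Set (Space d))} (h : Disjoint 𝓐 𝓑) (h𝓐 : 𝓐.Finite)
    (h𝓑 : 𝓑.Finite) (G : Set (Space d)) :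
    numContaining (𝓐 ∪ 𝓑) G = numContaining 𝓐 G + numContaining 𝓑 G := by
  unfold numContaining
  rw [← Set.ncard_union_eq (h.mono (Set.sep_subset _ _) (Set.sep_subset _ _))
    (h𝓐.subset (Set.sep_subset _ _)) (h𝓑.subset (Set.sep_subset _ _))]
  congr 1
  ext F
  exact or_and_right

/-- The facets through `G`, split into those that the apex is beneath, on, and beyond. -/
theorem fdeg_eq_add (hP : IsFullPolytope P) (h𝓕 : 𝓕 ⊆ facets P) (h𝓝 : 𝓝 ∪ {S} ⊆ facets P)
    (hv : v ∈ region P S 𝓕 𝓝) (G : Set (Space d)) :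
    fdeg P G = numContaining {F ∈ facets P | height P F v < 0} G + numContaining 𝓕 G +
      numContaining (𝓝 ∪ {S}) G := by
  have hfin := facets_finite hP
  have hneg : {F ∈ facets P | height P F v < 0} ⊆ facets P := Set.sep_subset _ _
  have hpos : ∀ F ∈ 𝓝 ∪ {S}, 0 < height P F v := fun F h =>
    height_pos_of_mem_region hP (h𝓝 h) hv h
  have hzero : ∀ F ∈ 𝓕, height P F v = 0 := fun F h =>
    height_eq_zero_of_mem_region (h𝓕 h) hv h
  have heq : facets P = {F ∈ facets P | height P F v < 0} ∪ 𝓕 ∪ (𝓝 ∪ {S}) := by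
    refine Set.Subset.antisymm (fun F hF => ?_)
      (Set.union_subset (Set.union_subset hneg h𝓕) h𝓝)
    by_cases h : F ∈ 𝓕 ∪ 𝓝 ∪ {S}
    · rcases h with (h | h) | h
      exacts [Or.inl (Or.inr h), Or.inr (Or.inl h), Or.inr (Or.inr h)]
    · exact Or.inl (Or.inl ⟨hF, height_neg_of_mem_region hP hF hv h⟩)
  have hd1 : Disjoint {F ∈ facets P | height P F v < 0} 𝓕 :=
    Set.disjoint_left.2 fun F h h' => h.2.ne (hzero F h')
  have hd2 : Disjoint ({F ∈ facets P | height P F v < 0} ∪ 𝓕) (𝓝 ∪ {S}) := by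
    refine Set.disjoint_left.2 ?_
    rintro F (h | h) h'
    exacts [h.2.not_gt (hpos F h'), (hpos F h').ne' (hzero F h)]
  rw [fdeg, ← numContaining_union hd1 (hfin.subset hneg) (hfin.subset h𝓕),
    ← numContaining_union hd2 ((hfin.subset hneg).union (hfin.subset h𝓕)) (hfin.subset h𝓝),
    ← heq]

/-- If `G` lies in a facet that the apex is beyond and in one that it is beneath, then `G` remains
a face, and the facets through `G` that the apex is not beneath are replaced by two others. -/
theorem isFace_and_fdeg_add (hP : IsFullPolytope P) (h𝓕 : 𝓕 ⊆ facets P)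
    (h𝓝 : 𝓝 ∪ {S} ⊆ facets P) (hv : v ∈ region P S 𝓕 𝓝) (hG : IsSubridge P G)
    {A B : Set (Space d)} (hA : A ∈ facets P) (hGA : G ⊆ A) (hA' : A ∉ 𝓕 ∪ 𝓝 ∪ {S})
    (hB : B ∈ 𝓝 ∪ {S}) (hGB : G ⊆ B) :
    IsFace (convexHull ℝ (P ∪ {v})) G ∧
      fdeg (convexHull ℝ (P ∪ {v})) G + numContaining 𝓕 G + numContaining (𝓝 ∪ {S}) G =
        fdeg P G + 2 := by
  have hAv := height_neg_of_mem_region hP hA hv hA'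
  have hBv := height_pos_of_mem_region hP (h𝓝 hB) hv hB
  refine ⟨hG.1.convexHull_union hP hG.2.1 hA hGA hAv, ?_⟩
  rw [fdeg_convexHull_union hP hG hA hGA hAv (h𝓝 hB) hGB hBv, fdeg_eq_add hP h𝓕 h𝓝 hv G]
  omega

/-- If exactly three facets `A`, `B`, `S` contain a subridge `G`, then `A` and `B` are adjacent. -/
theorem isRidge_inter_of_three_facets (hP : IsFullPolytope P) (hS : S ∈ facets P)
    (hG : IsSubridge P G) {A B : Set (Space d)} (hA : A ∈ facets P) (hB : B ∈ facets P)
    (hAB : A ≠ B) (hGA : G ⊆ A) (hGB : G ⊆ B) (hGS : G ⊆ S)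
    (h : ∀ F ∈ facets P, G ⊆ F → F = S ∨ F = A ∨ F = B) : IsRidge P (A ∩ B) := by
  have hdG : finrank ℝ (vectorSpan ℝ G) + 3 = d := hG.2.2
  obtain ⟨g, hg, hcone⟩ := hG.1.exists_forall_add_smul_mem hP hG.2.1
  -- A direction along the hyperplanes of `A` and `B` that is not parallel to `G`.
  obtain ⟨u, ⟨huA, huB⟩, hu⟩ : ∃ u ∈ LinearMap.ker (normal P A : Space d →ₗ[ℝ] ℝ) ⊓
      LinearMap.ker (normal P B : Space d →ₗ[ℝ] ℝ), u ∉ vectorSpan ℝ G := by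
    by_contra! hle
    have h1 := Submodule.finrank_mono (show _ ≤ _ from hle)
    have h2 := Submodule.finrank_sup_add_finrank_inf_eq
      (LinearMap.ker (normal P A : Space d →ₗ[ℝ] ℝ))
      (LinearMap.ker (normal P B : Space d →ₗ[ℝ] ℝ))
    have h3 := finrank_ker_add_one (normal_ne_zero hP hA)
    have h4 := finrank_ker_add_one (normal_ne_zero hP hB)
    have h5 := Submodule.finrank_le (LinearMap.ker (normal P A : Space d →ₗ[ℝ] ℝ) ⊔
      LinearMap.ker (normal P B : Space d →ₗ[ℝ] ℝ))
    rw [finrank_euclideanSpace_fin] at h5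
    omega
  replace huA : normal P A u = 0 := huA
  replace huB : normal P B u = 0 := huB
  have huS : normal P S u ≠ 0 := fun h0 => hu <| hG.1.mem_vectorSpan hP hG.2.1 fun F hF hGF => by
    rcases h F hF hGF with rfl | rfl | rfl <;> assumption
  obtain ⟨w, hwA, hwB, hwS⟩ : ∃ w, normal P A w = 0 ∧ normal P B w = 0 ∧ normal P S w < 0 := by
    rcases huS.lt_or_gt with hlt | hgt
    · exact ⟨u, huA, huB, hlt⟩
    · exact ⟨-u, by simp [huA], by simp [huB], by simpa using hgt⟩
  obtain ⟨t, ht, hmem⟩ := hcone w fun F hF hGF => by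
    rcases h F hF hGF with rfl | rfl | rfl
    exacts [hwS.le, hwA.le, hwB.le]
  have hxA : g + t • w ∈ A := (mem_facet_iff hA).2
    ⟨hmem, by rw [height_add_smul, height_eq_zero hA (hGA hg), hwA]; ring⟩
  have hxB : g + t • w ∈ B := (mem_facet_iff hB).2
    ⟨hmem, by rw [height_add_smul, height_eq_zero hB (hGB hg), hwB]; ring⟩
  have hxG : g + t • w ∉ G := fun hx => by
    have := height_eq_zero hS (hGS hx)
    rw [height_add_smul, height_eq_zero hS (hGS hg)] at this
    have := mul_neg_of_pos_of_neg ht hwS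
    linarith
  have hf := hA.1.inter hB.1
  have hsub := Set.subset_inter hGA hGB
  have h1 := hG.1.dim_lt_of_ssubset hG.2.1 hf
    (Set.ssubset_iff_subset_ne.2 ⟨hsub, fun h => hxG (h ▸ ⟨hxA, hxB⟩)⟩)
  have hne := hG.2.1.mono hsub
  have h2 := dim_inter_facets hA hB hAB hne
  refine ⟨hf, hne, ?_⟩
  unfold dim at h1 h2 ⊢
  omega

/-- Nonsimplicity forces a facet through a subridge of `S` other than `S` and outside `𝓕`. -/
theorem Nonsimple.exists_facet (hP : IsFullPolytope P) (hS : S ∈ facets P) (h𝓕 : 𝓕 ⊆ adj P S)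
    (hns : Nonsimple P S 𝓕) (hG : IsSubridge P G) (hGS : G ⊆ S) :
    ∃ F ∈ facets P, G ⊆ F ∧ F ≠ S ∧ F ∉ 𝓕 := by
  by_contra! h
  have hfin : {F | F ∈ 𝓕 ∧ G ⊆ F}.Finite :=
    (facets_containing_finite hP G).subset fun F hF => ⟨(h𝓕 hF.1).1, hF.2⟩
  have h1 := hG.1.le_dim_add_fdeg hP hG.2.1
  have h2 := hG.2.2
  have h3 : fdeg P G ≤ numContaining 𝓕 G + 1 := by
    refine (Set.ncard_le_ncard (t := insert S {F | F ∈ 𝓕 ∧ G ⊆ F}) (fun F hF => ?_)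
      (hfin.insert S)).trans (Set.ncard_insert_le _ _)
    by_cases hFS : F = S
    · exact Or.inl hFS
    · exact Or.inr ⟨h F hF.1 hF.2 hFS, hF.2⟩
  have h4 := numContaining_le_two hP hS h𝓕 hG hGS
  have h5 : numContaining 𝓕 G = 2 := by omega
  obtain ⟨A, B, hAB, heq⟩ := Set.ncard_eq_two.1 h5
  have hA : A ∈ {F | F ∈ 𝓕 ∧ G ⊆ F} := heq ▸ Or.inl rfl
  have hB : B ∈ {F | F ∈ 𝓕 ∧ G ⊆ F} := heq ▸ Or.inr rfl
  refine hns ⟨A, hA.1, B, hB.1, ⟨(h𝓕 hB.1).1, hAB.symm, ?_⟩, G, hG, hA.2, hB.2, hGS⟩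
  refine isRidge_inter_of_three_facets hP hS hG (h𝓕 hA.1).1 (h𝓕 hB.1).1 hAB hA.2 hB.2 hGS
    fun F hF hGF => or_iff_not_imp_left.2 fun hFS => ?_
  have : F ∈ {F | F ∈ 𝓕 ∧ G ⊆ F} := ⟨h F hF hGF hFS, hGF⟩
  rw [heq] at this
  exact this

theorem numContaining_singleton (S G : Set (Space d)) : numContaining {S} G = eps S G := by
  unfold numContaining eps
  split_ifs with h
  · have : {F | F ∈ ({S} : Set (Set (Space d))) ∧ G ⊆ F} = {S} := by
      ext F; constructor
      · exact fun hF => hF.1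
      · rintro rfl; exact ⟨rfl, h⟩
    rw [this, Set.ncard_singleton]
  · have : {F | F ∈ ({S} : Set (Set (Space d))) ∧ G ⊆ F} = ∅ := by
      ext F
      simp only [Set.mem_empty_iff_false, iff_false]
      rintro ⟨rfl, hF⟩
      exact h hF
    rw [this, Set.ncard_empty]

theorem numContaining_pair (hNS : N ≠ S) (G : Set (Space d)) :
    numContaining ({N} ∪ {S}) G = eps N G + eps S G := by
  rw [numContaining_union (Set.disjoint_singleton.2 hNS) (Set.finite_singleton N)
    (Set.finite_singleton S), numContaining_singleton, numContaining_singleton]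

end PseudoStacking

open PseudoStacking
theorem proposition2p12 (d : ℕ) (hd : 3 ≤ d) (P S : Set (Space d)) (hP : IsFullPolytope P)
    (hS : IsSimplexFacet P S) (hb : BoundedPosition P S)
    (𝓕 : Set (Set (Space d))) (h𝓕 : 𝓕 ⊆ adj P S) (hns : Nonsimple P S 𝓕)
    (G : Set (Space d)) (hG : IsSubridge P G) :
    (G ⊆ S →
      numContaining 𝓕 G ≤ 2 ∧
      ∀ Q, IsPseudoStacking P S 𝓕 ∅ Q →
        IsFace Q G ∧ (fdeg Q G : ℤ) = fdeg P G + 1 - numContaining 𝓕 G) ∧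
    (∀ N ∈ adj P S \ 𝓕, ∀ Q, IsPseudoStacking P S 𝓕 {N} Q →
      (G ⊆ S → ¬ G ⊆ N →
        IsFace Q G ∧ (fdeg Q G : ℤ) = fdeg P G + 1 - numContaining 𝓕 G) ∧
      (G ⊆ N →
        ((∀ F ∈ facets P, G ⊆ F → F = S ∨ F = N ∨ F ∈ 𝓕) → ¬ IsFace Q G) ∧
        (¬ (∀ F ∈ facets P, G ⊆ F → F = S ∨ F = N ∨ F ∈ 𝓕) →
          IsFace Q G ∧
            (fdeg Q G : ℤ) = fdeg P G + 1 - eps S G - numContaining 𝓕 G))) := by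
  have hSf := hS.1
  have h𝓕f : 𝓕 ⊆ facets P := fun F hF => (h𝓕 hF).1
  refine ⟨fun hGS => ⟨numContaining_le_two hP hSf h𝓕 hG hGS, ?_⟩, ?_⟩
  · rintro Q ⟨v, hv, rfl⟩
    obtain ⟨A, hA, hGA, hAS, hA𝓕⟩ := hns.exists_facet hP hSf h𝓕 hG hGS
    obtain ⟨h1, h2⟩ := isFace_and_fdeg_add hP h𝓕f (by simpa using hSf) hv hG hA hGA
      (by simp [hAS, hA𝓕]) (Or.inr rfl) hGS
    refine ⟨h1, ?_⟩
    rw [Set.empty_union, numContaining_singleton, eps, if_pos hGS] at h2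
    omega
  · rintro N ⟨hN, hN𝓕⟩ Q ⟨v, hv, rfl⟩
    have h𝓝 : {N} ∪ {S} ⊆ facets P := by
      rintro F (rfl | rfl)
      exacts [hN.1, hSf]
    have hcount := numContaining_pair hN.2.1 G
    refine ⟨fun hGS hGN => ?_, fun hGN => ⟨fun hall => ?_, fun hex => ?_⟩⟩
    · obtain ⟨A, hA, hGA, hAS, hA𝓕⟩ := hns.exists_facet hP hSf h𝓕 hG hGS
      have hAN : A ≠ N := fun h => hGN (h ▸ hGA)
      obtain ⟨h1, h2⟩ := isFace_and_fdeg_add hP h𝓕f h𝓝 hv hG hA hGA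
        (by simp [hAS, hA𝓕, hAN]) (Or.inr rfl) hGS
      refine ⟨h1, ?_⟩
      rw [hcount, eps, eps, if_neg hGN, if_pos hGS] at h2
      omega
    · refine not_isFace_convexHull_union hP hG.1 hG.2.1 (fun hvP => ?_) fun F hF hGF => ?_
      · exact (height_nonpos hSf hvP).not_gt (height_pos_of_mem_region hP hSf hv (Or.inr rfl))
      · rcases hall F hF hGF with rfl | rfl | h
        · exact (height_pos_of_mem_region hP hF hv (Or.inr rfl)).le
        · exact (height_pos_of_mem_region hP hF hv (Or.inl rfl)).le
        · exact (height_eq_zero_of_mem_region hF hv h).ge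
    · push Not at hex
      obtain ⟨A, hA, hGA, hAS, hAN, hA𝓕⟩ := hex
      obtain ⟨h1, h2⟩ := isFace_and_fdeg_add hP h𝓕f h𝓝 hv hG hA hGA
        (by simp [hAS, hA𝓕, hAN]) (Or.inl rfl) hGN
      refine ⟨h1, ?_⟩
      rw [hcount, eps, if_pos hGN] at h2
      omega
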